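/- Let $G$ be a metric group, that is, a topological group whose topology is generated by some metric. Then the following twelve conditions are equivalent. (i) $G$ is Sánchez-Okunev countably compact: $G$ has a countably compact pseudobase consisting of zero-sets. (ii) $G$ is Oxtoby countably compact: $G$ has a countably compact pseudobase consisting of open sets. (iii) $G$ is Todd countably compact: $G$ has a countably compact pseudobase. (iv) $G$ is strongly Sánchez-Okunev pseudocomplete: there is a family $\mathcal B$ of zero-sets of $G$ such that the constant sequence $\mathcal B_n=\mathcal B$ is complete. (v) $G$ is strongly Oxtoby pseudocomplete: there is a family $\mathcal B$ of open sets of $G$ such that the constant sequence $\mathcal B_n=\mathcal B$ is complete. (vi) $G$ is strongly Todd pseudocomplete: there is a family $\mathcal B$ of subsets of $G$ such that the constant sequence $\mathcal B_n=\mathcal B$ is complete. (vii) $G$ is Sánchez-Okunev pseudocomplete: $G$ has a complete sequence $\{\mathcal B_n\}_{n\in\mathbb N}$ in which every $\mathcal B_n$ consists of zero-sets. (viii) $G$ is Oxtoby pseudocomplete: $G$ has a complete sequence $\{\mathcal B_n\}_{n\in\mathbb N}$ in which every $\mathcal B_n$ consists of open sets. (ix) $G$ is Todd pseudocomplete: $G$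 has a complete sequence. (x) $G$ contains a dense zero-dimensional completely metrizable subspace $Z$ (zero-dimensional means that the clopen subsets of $Z$ form a base of $Z$). (xi) $G$ is Čech-complete: $G$ is Tychonoff and is a $G_\delta$-set in its Stone–Čech compactification $\beta G$. (xii) $G$ is Telgársky pseudocomplete: $G$ has a complete sequence $\{\mathcal B_n\}_{n\in\mathbb N}$ in which every $\mathcal B_n$ is a base of the topology of $G$. In particular, a Todd pseudocomplete metric group is Čech-complete. Here the following terminology is used for a topological space $X$. A *zero-set* is a set $f^{-1}(\{0\})$ with $f:X\to\mathbb R$ continuous. A family $\mathcal B$ of subsets of $X$ is a *pseudobase* if every $B\in\mathcal B$ has non-empty interior and every non-empty open subset of $X$ contains a member of $\mathcal B$. A family of non-empty sets is *countably compact* if every decreasing sequence of its members has non-empty intersection. A sequence $\{B_n\}_{n\in\mathbb N}$ of subsets of $X$ is *nested* if $\overline{B_{n+1}}\subseteq\operatorname{Int} B_n$ for all $n$. A sequence $\{\mathcal B_n\}_{n\in\mathbb N}$ of families of subsets of $X$ is *complete* if each $\mathcal B_n$ is a pseudobase of $X$ and $\bigcap_n B_n\neq\emptyset$ for every nested sequence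 $\{B_n\}$ with $B_n\in\mathcal B_n$ for all $n$. -/

import Mathlib

open Set TopologicalSpace

namespace Pseudocomplete

variable {X : Type*} [TopologicalSpace X]

/-- A sequence of sets is nested if the closure of each term lies in the interior of the
preceding one. -/
def IsNested (B : ℕ → Set X) : Prop :=
  ∀ n, closure (B (n + 1)) ⊆ interior (B n)

/-- A pseudobase: a family of sets with non-empty interior such that every non-empty open set
contains a member of the family. The members need not be open. -/
def IsPseudobase (𝓑 : Set (Set X)) : Prop :=
  (∀ B ∈ 𝓑, (interior B).Nonempty) ∧
    ∀ U : Set X, IsOpen U → U.Nonempty → ∃ B ∈ 𝓑, B ⊆ U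

/-- A sequence of families is centered if every nested sequence with `n`-th term in the `n`-th
family has non-empty intersection. -/
def IsCentered (𝓑 : ℕ → Set (Set X)) : Prop :=
  ∀ B : ℕ → Set X, IsNested B → (∀ n, B n ∈ 𝓑 n) → (⋂ n, B n).Nonempty

/-- A complete sequence is a centered sequence of pseudobases. -/
def IsCompleteSeq (𝓑 : ℕ → Set (Set X)) : Prop :=
  IsCentered 𝓑 ∧ ∀ n, IsPseudobase (𝓑 n)

/-- A countably compact family: a family of non-empty sets in which every decreasing sequence
has non-empty intersection. -/
def IsCCFamily (𝓕 : Set (Set X)) : Prop :=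
  (∀ F ∈ 𝓕, F.Nonempty) ∧
    ∀ F : ℕ → Set X, Antitone F → (∀ n, F n ∈ 𝓕) → (⋂ n, F n).Nonempty

/-- A zero-set is the set of zeros of a continuous real-valued function. -/
def IsZeroSet (Z : Set X) : Prop :=
  ∃ f : C(X, ℝ), Z = {x | f x = 0}

variable (X)

/-- Todd pseudocomplete. -/
def ToddPseudocomplete : Prop :=
  ∃ 𝓑 : ℕ → Set (Set X), IsCompleteSeq 𝓑

/-- Oxtoby pseudocomplete. -/
def OxtobyPseudocomplete : Prop :=
  ∃ 𝓑 : ℕ → Set (Set X), IsCompleteSeq 𝓑 ∧ ∀ n, ∀ B ∈ 𝓑 n, IsOpen B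

/-- Sánchez-Okunev pseudocomplete. -/
def SanchezOkunevPseudocomplete : Prop :=
  ∃ 𝓑 : ℕ → Set (Set X), IsCompleteSeq 𝓑 ∧ ∀ n, ∀ B ∈ 𝓑 n, IsZeroSet B

/-- Telgársky pseudocomplete. -/
def TelgarskyPseudocomplete : Prop :=
  ∃ 𝓑 : ℕ → Set (Set X), IsCompleteSeq 𝓑 ∧ ∀ n, IsTopologicalBasis (𝓑 n)

/-- Strongly Todd pseudocomplete: all terms of the complete sequence are the same family. -/
def StronglyToddPseudocomplete : Prop :=
  ∃ 𝓑 : Set (Set X), IsCompleteSeq fun _ : ℕ => 𝓑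

/-- Strongly Oxtoby pseudocomplete. -/
def StronglyOxtobyPseudocomplete : Prop :=
  ∃ 𝓑 : Set (Set X), (IsCompleteSeq fun _ : ℕ => 𝓑) ∧ ∀ B ∈ 𝓑, IsOpen B

/-- Strongly Sánchez-Okunev pseudocomplete. -/
def StronglySanchezOkunevPseudocomplete : Prop :=
  ∃ 𝓑 : Set (Set X), (IsCompleteSeq fun _ : ℕ => 𝓑) ∧ ∀ B ∈ 𝓑, IsZeroSet B

/-- Todd countably compact. -/
def ToddCC : Prop :=
  ∃ 𝓑 : Set (Set X), IsCCFamily 𝓑 ∧ IsPseudobase 𝓑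

/-- Oxtoby countably compact. -/
def OxtobyCC : Prop :=
  ∃ 𝓑 : Set (Set X), IsCCFamily 𝓑 ∧ IsPseudobase 𝓑 ∧ ∀ B ∈ 𝓑, IsOpen B

/-- Sánchez-Okunev countably compact. -/
def SanchezOkunevCC : Prop :=
  ∃ 𝓑 : Set (Set X), IsCCFamily 𝓑 ∧ IsPseudobase 𝓑 ∧ ∀ B ∈ 𝓑, IsZeroSet B

/-- A zero-dimensional space: the clopen sets form a base. -/
def ZeroDimensional : Prop :=
  IsTopologicalBasis {U : Set X | IsClopen U}

/-- Čech-complete: a Tychonoff space that is a `Gδ`-set in its Stone–Čech compactification. -/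
def CechComplete : Prop :=
  T35Space X ∧ IsGδ (Set.range (stoneCechUnit : X → StoneCech X))

/-- `X` contains a dense zero-dimensional completely metrizable subspace. -/
def HasDenseZeroDimCompletelyMetrizable : Prop :=
  ∃ Z : Set X, Dense Z ∧ ZeroDimensional Z ∧ IsCompletelyMetrizableSpace Z

end Pseudocomplete

namespace Pseudocomplete

open Filter Topology

/-! ### Trees of disjoint open sets -/

section General

variable {X : Type*} [TopologicalSpace X]

/-! Todd pseudocompleteness is the hub. Zorn's lemma turns a complete sequence into a tree of open
sets: disjoint families with dense unions, each refining the last, with diameters tending to 0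
(`ToddPseudocomplete.exists_isCompleteTree`). Two nodes that meet are comparable, so a pairwise
meeting sequence of nodes has a common point (`iInter_nonempty_of_meet`); this gives the countable
compactness conditions. The points lying in a node at every level form the dense subspace of (x).

The group structure serves only to reach Čech-completeness. For a two-sided Cauchy sequence `g`, one
chooses decreasing open `U_n`, `V_n` with `g m * U_n ⊆ V_n` for large `m` and `V_n` shrinking.
Points `x ∈ ⋂ U_n` and `y ∈ ⋂ V_n` then satisfy `g m * x → y`, so `g` converges and the two-sided
uniformity is complete. -/

lemma IsNested.antitone {B : ℕ → Set X} (hB : IsNested B) : Antitone B :=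
  antitone_nat_of_succ_le fun n => subset_closure.trans ((hB n).trans interior_subset)

lemma IsCCFamily.isCentered {𝓑 : Set (Set X)} (h : IsCCFamily 𝓑) :
    IsCentered fun _ : ℕ => 𝓑 :=
  fun B hB hmem => h.2 B hB.antitone hmem

lemma isZeroSet_of_isClosed [MetrizableSpace X] {Z : Set X} (hZ : IsClosed Z) : IsZeroSet Z := by
  let := metrizableSpaceMetric X
  rcases Z.eq_empty_or_nonempty with rfl | hne
  · exact ⟨1, by ext; simp⟩
  · refine ⟨⟨fun x => Metric.infDist x Z, Metric.continuous_infDist_pt Z⟩, ?_⟩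
    ext x
    simpa using hZ.mem_iff_infDist_zero hne

/-- A sequence of disjoint families of open sets with dense unions, each refining the preceding
one, which shrink at every point and whose branches have non-empty intersection. -/
structure IsCompleteTree (𝓤 : ℕ → Set (Set X)) : Prop where
  isOpen : ∀ n, ∀ U ∈ 𝓤 n, IsOpen U
  nonempty : ∀ n, ∀ U ∈ 𝓤 n, U.Nonempty
  eq_of_meet : ∀ n, ∀ U ∈ 𝓤 n, ∀ V ∈ 𝓤 n, (U ∩ V).Nonempty → U = V
  meets : ∀ n, ∀ W : Set X, IsOpen W → W.Nonempty → ∃ U ∈ 𝓤 n, (U ∩ W).Nonempty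
  refines : ∀ n, ∀ U ∈ 𝓤 (n + 1), ∃ P ∈ 𝓤 n, U ⊆ P
  small : ∀ x, ∀ O : Set X, IsOpen O → x ∈ O → ∃ n, ∀ U ∈ 𝓤 n, x ∈ U → U ⊆ O
  complete : ∀ U : ℕ → Set X, (∀ n, U n ∈ 𝓤 n) → Antitone U → (⋂ n, U n).Nonempty

namespace IsCompleteTree

variable {𝓤 : ℕ → Set (Set X)} (h : IsCompleteTree 𝓤)
include h

lemma exists_superset {m n : ℕ} (hmn : m ≤ n) {U : Set X} (hU : U ∈ 𝓤 n) :
    ∃ P ∈ 𝓤 m, U ⊆ P := by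
  induction n, hmn using Nat.le_induction generalizing U with
  | base => exact ⟨U, hU, Subset.rfl⟩
  | succ n _ ih =>
    obtain ⟨P, hP, hUP⟩ := h.refines n U hU
    obtain ⟨Q, hQ, hPQ⟩ := ih hP
    exact ⟨Q, hQ, hUP.trans hPQ⟩

lemma subset_of_meet {m n : ℕ} (hmn : m ≤ n) {U V : Set X} (hU : U ∈ 𝓤 m) (hV : V ∈ 𝓤 n)
    (hUV : (U ∩ V).Nonempty) : V ⊆ U := by
  obtain ⟨P, hP, hVP⟩ := h.exists_superset hmn hV
  rwa [h.eq_of_meet m U hU P hP (hUV.mono (inter_subset_inter_right U hVP))]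

/-- If the levels are bounded, a deepest set lies in all the others. Otherwise the ancestors of the
`F k` form a branch, and each `F i` is the node of that branch at its own level. -/
lemma iInter_nonempty_of_meet {F : ℕ → Set X} (hF : ∀ k, ∃ n, F k ∈ 𝓤 n)
    (hmeet : ∀ j k, (F j ∩ F k).Nonempty) : (⋂ k, F k).Nonempty := by
  choose l hl using hF
  by_cases hb : ∃ j, ∀ k, l k ≤ l j
  · obtain ⟨j, hj⟩ := hb
    exact (h.nonempty _ _ (hl j)).mono
      (subset_iInter fun k => h.subset_of_meet (hj k) (hl k) (hl j) (hmeet k j))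
  · have hub : ∀ n, ∃ k, n ≤ l k := by
      by_contra! hn
      obtain ⟨n, hn⟩ := hn
      have hfin : (range l).Finite := (finite_lt_nat n).subset (by rintro _ ⟨k, rfl⟩; exact hn k)
      obtain ⟨_, ⟨j, rfl⟩, hj⟩ := exists_max_image (range l) id hfin (range_nonempty l)
      exact hb ⟨j, fun k => hj _ (mem_range_self k)⟩
    choose k hk using hub
    have hP : ∀ n, ∃ P ∈ 𝓤 n, F (k n) ⊆ P := fun n => h.exists_superset (hk n) (hl _)
    choose P hP hFP using hP
    have hmeetP : ∀ i m n, (F i ∩ P n).Nonempty ∧ (P m ∩ P n).Nonempty := fun i m n =>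
      ⟨(hmeet i (k n)).mono (inter_subset_inter_right _ (hFP n)),
        (hmeet (k m) (k n)).mono (inter_subset_inter (hFP m) (hFP n))⟩
    obtain ⟨z, hz⟩ := h.complete P hP fun m n hmn =>
      h.subset_of_meet hmn (hP m) (hP n) (hmeetP 0 m n).2
    refine ⟨z, mem_iInter.2 fun i => ?_⟩
    rw [h.eq_of_meet _ _ (hl i) _ (hP (l i)) (hmeetP i 0 _).1]
    exact mem_iInter.1 hz _

lemma dense_iInter [RegularSpace X] : Dense (⋂ n, ⋃₀ 𝓤 n) := by
  rw [dense_iff_inter_open]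
  rintro O hO ⟨x, hx⟩
  obtain ⟨C, hC, hCcl, hCO⟩ := exists_mem_nhds_isClosed_subset (hO.mem_nhds hx)
  have hWne : (interior C).Nonempty := ⟨x, mem_interior_iff_mem_nhds.2 hC⟩
  have hstep : ∀ n, ∀ U : {U // U ∈ 𝓤 n ∧ (U ∩ interior C).Nonempty},
      ∃ V : {V // V ∈ 𝓤 (n + 1) ∧ (V ∩ interior C).Nonempty}, V.1 ⊆ U.1 := by
    rintro n ⟨U, hU, hUC⟩
    obtain ⟨V, hV, hVU⟩ := h.meets (n + 1) _ ((h.isOpen n U hU).inter isOpen_interior) hUC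
    exact ⟨⟨V, hV, hVU.mono fun y hy => ⟨hy.1, hy.2.2⟩⟩,
      h.subset_of_meet n.le_succ hU hV (hVU.mono fun y hy => ⟨hy.2.1, hy.1⟩)⟩
  choose next hnext using hstep
  obtain ⟨U₀, hU₀⟩ := h.meets 0 _ isOpen_interior hWne
  let S : ∀ n, {U // U ∈ 𝓤 n ∧ (U ∩ interior C).Nonempty} := fun n =>
    Nat.rec ⟨U₀, hU₀⟩ (fun n U => next n U) n
  obtain ⟨z, hz⟩ := h.complete (fun n => (S n).1) (fun n => (S n).2.1)
    (antitone_nat_of_succ_le fun n => hnext n (S n))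
  rw [mem_iInter] at hz
  refine ⟨z, hCO ?_, mem_iInter.2 fun n => ⟨_, (S n).2.1, hz n⟩⟩
  -- Every node of the branch meets `C`, whereas off the closed set `C` a small node around `z`
  -- would miss it.
  by_contra hzC
  obtain ⟨n, hn⟩ := h.small z Cᶜ hCcl.isOpen_compl hzC
  obtain ⟨y, hyS, hyC⟩ := (S n).2.2
  exact hn _ (S n).2.1 (hz n) hyS (interior_subset hyC)

lemma exists_subset [RegularSpace X] {O : Set X} (hO : IsOpen O) (hne : O.Nonempty) :
    ∃ n, ∃ U ∈ 𝓤 n, U ⊆ O := by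
  obtain ⟨z, hzO, hz⟩ := h.dense_iInter.inter_open_nonempty O hO hne
  obtain ⟨n, hn⟩ := h.small z O hO hzO
  obtain ⟨U, hU, hzU⟩ := mem_iInter.1 hz n
  exact ⟨n, U, hU, hn U hU hzU⟩

lemma oxtobyCC [RegularSpace X] : OxtobyCC X := by
  refine ⟨⋃ n, 𝓤 n, ⟨?_, ?_⟩, ⟨?_, ?_⟩, ?_⟩
  · rintro U hU
    obtain ⟨n, hU⟩ := mem_iUnion.1 hU
    exact h.nonempty n U hU
  · intro F hF hmem
    simp only [mem_iUnion] at hmem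
    refine h.iInter_nonempty_of_meet hmem fun j k => ?_
    obtain ⟨n, hn⟩ := hmem (max j k)
    exact (h.nonempty n _ hn).mono
      (subset_inter (hF (le_max_left j k)) (hF (le_max_right j k)))
  · rintro U hU
    obtain ⟨n, hU⟩ := mem_iUnion.1 hU
    rw [(h.isOpen n U hU).interior_eq]
    exact h.nonempty n U hU
  · intro O hO hne
    obtain ⟨n, U, hU, hUO⟩ := h.exists_subset hO hne
    exact ⟨U, mem_iUnion.2 ⟨n, hU⟩, hUO⟩
  · rintro U hU
    obtain ⟨n, hU⟩ := mem_iUnion.1 hU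
    exact h.isOpen n U hU

lemma sanchezOkunevCC [MetrizableSpace X] : SanchezOkunevCC X := by
  refine ⟨{B | ∃ n, ∃ U ∈ 𝓤 n, closure U = B}, ⟨?_, ?_⟩, ⟨?_, ?_⟩, ?_⟩
  · rintro _ ⟨n, U, hU, rfl⟩
    exact (h.nonempty n U hU).closure
  · intro F hF hmem
    choose n U hU hUF using hmem
    refine (h.iInter_nonempty_of_meet (F := U) (fun k => ⟨n k, hU k⟩) ?_).mono
      (iInter_mono fun k => (hUF k) ▸ subset_closure)
    -- The open set `U k` lies in `closure (U j)`, hence meets `U j` itself.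
    have key : ∀ j k, j ≤ k → (U j ∩ U k).Nonempty := fun j k hjk => by
      obtain ⟨y, hy⟩ := h.nonempty _ _ (hU k)
      have hyj : y ∈ closure (U j) := by
        rw [hUF j]
        exact hF hjk (hUF k ▸ subset_closure hy)
      rw [inter_comm]
      exact mem_closure_iff.1 hyj _ (h.isOpen _ _ (hU k)) hy
    intro j k
    rcases le_total j k with hjk | hjk
    · exact key j k hjk
    · rw [inter_comm]
      exact key k j hjk
  · rintro _ ⟨n, U, hU, rfl⟩
    exact (h.nonempty n U hU).mono (interior_maximal subset_closure (h.isOpen n U hU))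
  · rintro O hO ⟨x, hx⟩
    obtain ⟨C, hC, hCcl, hCO⟩ := exists_mem_nhds_isClosed_subset (hO.mem_nhds hx)
    obtain ⟨n, U, hU, hUC⟩ :=
      h.exists_subset isOpen_interior ⟨x, mem_interior_iff_mem_nhds.2 hC⟩
    exact ⟨_, ⟨n, U, hU, rfl⟩,
      (closure_minimal (hUC.trans interior_subset) hCcl).trans hCO⟩
  · rintro _ ⟨n, U, hU, rfl⟩
    exact isZeroSet_of_isClosed isClosed_closure

/-- On this subspace the nodes of one level form an open partition, so their traces are clopen. -/
lemma zeroDimensional_iInter : ZeroDimensional (⋂ n, ⋃₀ 𝓤 n : Set X) := by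
  refine isTopologicalBasis_of_isOpen_of_nhds (fun U hU => hU.isOpen) ?_
  rintro ⟨z, hz⟩ O hzO hO
  obtain ⟨O', hO', rfl⟩ := isOpen_induced_iff.1 hO
  obtain ⟨n, hn⟩ := h.small z O' hO' hzO
  obtain ⟨U, hU, hzU⟩ := mem_iInter.1 hz n
  refine ⟨Subtype.val ⁻¹' U, ⟨?_, ?_⟩, hzU, preimage_mono (hn U hU hzU)⟩
  · have hV : IsOpen (⋃₀ (𝓤 n \ {U})) := isOpen_sUnion fun V hV => h.isOpen n V hV.1
    have heq : (Subtype.val ⁻¹' U : Set (⋂ n, ⋃₀ 𝓤 n : Set X)) =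
        (Subtype.val ⁻¹' ⋃₀ (𝓤 n \ {U}))ᶜ := by
      ext ⟨y, hy⟩
      obtain ⟨V, hV, hyV⟩ := mem_iInter.1 hy n
      simp only [mem_preimage, mem_compl_iff, mem_sUnion, not_exists, not_and]
      constructor
      · intro hyU W hW hyW
        exact hW.2 (h.eq_of_meet n W hW.1 U hU ⟨y, hyW, hyU⟩)
      · intro hW
        by_contra hyU
        exact hW V ⟨hV, fun hVU => hyU (hVU ▸ hyV)⟩ hyV
    rw [heq]
    exact (hV.preimage continuous_subtype_val).isClosed_compl
  · exact (h.isOpen n U hU).preimage continuous_subtype_val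

/-- Sending a point to its nodes is a closed embedding into a countable product of discrete spaces;
the image is the set of all branches. -/
lemma isCompletelyMetrizableSpace_iInter [T1Space X] :
    IsCompletelyMetrizableSpace (⋂ n, ⋃₀ 𝓤 n : Set X) := by
  let : ∀ n, TopologicalSpace (𝓤 n) := fun _ => ⊥
  have : ∀ n, DiscreteTopology (𝓤 n) := fun _ => ⟨rfl⟩
  have hex : ∀ (z : (⋂ n, ⋃₀ 𝓤 n : Set X)) (n : ℕ), ∃ U : 𝓤 n, z.1 ∈ U.1 := fun z n => by
    obtain ⟨U, hU, hzU⟩ := mem_iInter.1 z.2 n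
    exact ⟨⟨U, hU⟩, hzU⟩
  choose f hf using hex
  have huniq : ∀ z n (U : 𝓤 n), z.1 ∈ U.1 → f z n = U := fun z n U hU =>
    Subtype.ext (h.eq_of_meet n _ (f z n).2 _ U.2 ⟨z.1, hf z n, hU⟩)
  have hpre : ∀ n (U : 𝓤 n), (fun z => f z n) ⁻¹' {U} = Subtype.val ⁻¹' U.1 := fun n U => by
    ext z
    exact ⟨fun hz => (show f z n = U from hz) ▸ hf z n, huniq z n U⟩
  have hcont : Continuous f := continuous_pi fun n => continuous_discrete_rng.2 fun U => by
    rw [hpre]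
    exact (h.isOpen n U U.2).preimage continuous_subtype_val
  have hinj : Function.Injective f := fun z w hzw => by
    by_contra hne
    obtain ⟨n, hn⟩ := h.small z.1 {w.1}ᶜ isOpen_compl_singleton
      (fun h' => hne (Subtype.ext h'))
    refine hn _ (f z n).2 (hf z n) ?_ rfl
    rw [hzw]
    exact hf w n
  have hind : IsInducing f := by
    rw [isInducing_iff_nhds]
    refine fun z => le_antisymm (hcont.tendsto z).le_comap fun O hO => ?_
    obtain ⟨O', hO', hOO'⟩ := mem_nhds_induced _ _ _ |>.1 hO
    obtain ⟨W, hWO', hW, hzW⟩ := mem_nhds_iff.1 hO'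
    obtain ⟨n, hn⟩ := h.small z.1 W hW hzW
    refine ⟨(fun u => u n) ⁻¹' {f z n},
      ((isOpen_discrete _).preimage (continuous_apply n)).mem_nhds rfl, fun w hw => ?_⟩
    refine hOO' (hWO' (hn _ (f z n).2 (hf z n) ?_))
    rw [← show f w n = f z n from hw]
    exact hf w n
  have hrange : range f = ⋂ n, {u | (u (n + 1)).1 ⊆ (u n).1} := by
    ext u
    simp only [mem_iInter, mem_ofPred_eq]
    constructor
    · rintro ⟨z, rfl⟩ n
      exact h.subset_of_meet n.le_succ (f z n).2 (f z (n + 1)).2 ⟨z.1, hf z n, hf z (n + 1)⟩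
    · intro hu
      obtain ⟨z, hz⟩ := h.complete (fun n => (u n).1) (fun n => (u n).2)
        (antitone_nat_of_succ_le hu)
      rw [mem_iInter] at hz
      exact ⟨⟨z, mem_iInter.2 fun n => ⟨_, (u n).2, hz n⟩⟩,
        funext fun n => huniq _ n (u n) (hz n)⟩
  have hclosed : IsClosed (range f) := by
    rw [hrange]
    refine isClosed_iInter fun n => ?_
    have hpair : Continuous fun u : ∀ n, 𝓤 n => (u (n + 1), u n) :=
      (continuous_apply (n + 1)).prodMk (continuous_apply n)
    exact (isClosed_discrete {p : 𝓤 (n + 1) × 𝓤 n | p.1.1 ⊆ p.2.1}).preimage hpair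
  exact IsClosedEmbedding.IsCompletelyMetrizableSpace ⟨⟨hind, hinj⟩, hclosed⟩

lemma hasDenseZeroDimCompletelyMetrizable [T3Space X] :
    HasDenseZeroDimCompletelyMetrizable X :=
  ⟨_, h.dense_iInter, h.zeroDimensional_iInter, h.isCompletelyMetrizableSpace_iInter⟩

end IsCompleteTree

end General

/-! ### Building the tree, and returning from a dense subspace -/

section Metric

/-- Inside a family with dense union, a pseudobase contains a family of small sets with disjoint
interiors and dense union. -/
lemma IsPseudobase.exists_disjoint_refinement {X : Type*} [MetricSpace X] {𝓑 𝓓 : Set (Set X)}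
    (h𝓑 : IsPseudobase 𝓑)
    (h𝓓 : ∀ W : Set X, IsOpen W → W.Nonempty → ∃ P ∈ 𝓓, (interior P ∩ W).Nonempty)
    {ε : ℝ} (hε : 0 < ε) :
    ∃ 𝓠 ⊆ 𝓑, (∀ Q ∈ 𝓠, ∃ P ∈ 𝓓, closure Q ⊆ interior P) ∧
      (∀ Q ∈ 𝓠, ∀ x ∈ Q, Q ⊆ Metric.ball x ε) ∧ 𝓠.PairwiseDisjoint interior ∧
      ∀ W : Set X, IsOpen W → W.Nonempty → ∃ Q ∈ 𝓠, (interior Q ∩ W).Nonempty := by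
  let 𝓐 : Set (Set X) :=
    {B | B ∈ 𝓑 ∧ (∃ P ∈ 𝓓, closure B ⊆ interior P) ∧ ∀ x ∈ B, B ⊆ Metric.ball x ε}
  obtain ⟨𝓠, h𝓠⟩ := zorn_subset {𝓒 : Set (Set X) | 𝓒 ⊆ 𝓐 ∧ 𝓒.PairwiseDisjoint interior} (by
    intro c hc hchain
    refine ⟨⋃₀ c, ⟨sUnion_subset fun s hs => (hc hs).1, ?_⟩, fun s hs => subset_sUnion_of_mem hs⟩
    exact (pairwiseDisjoint_sUnion hchain.directedOn).2 fun s hs => (hc hs).2)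
  obtain ⟨h𝓠𝓐, hdisj⟩ := h𝓠.prop
  refine ⟨𝓠, fun Q hQ => (h𝓠𝓐 hQ).1, fun Q hQ => (h𝓠𝓐 hQ).2.1, fun Q hQ => (h𝓠𝓐 hQ).2.2,
    hdisj, fun W hW hWne => ?_⟩
  by_contra! hno
  obtain ⟨P, hP, x, hxP, hxW⟩ := h𝓓 W hW hWne
  -- If a maximal family missed `W`, a small member of `𝓑` inside this set could be added to it.
  have hO : IsOpen (interior P ∩ W ∩ Metric.ball x (ε / 2)) :=
    (isOpen_interior.inter hW).inter Metric.isOpen_ball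
  obtain ⟨C, hC, hCcl, hCO⟩ := exists_mem_nhds_isClosed_subset
    (hO.mem_nhds ⟨⟨hxP, hxW⟩, Metric.mem_ball_self (half_pos hε)⟩)
  obtain ⟨B, hB, hBC⟩ := h𝓑.2 _ isOpen_interior ⟨x, mem_interior_iff_mem_nhds.2 hC⟩
  replace hBC : B ⊆ C := hBC.trans interior_subset
  have hBW : interior B ⊆ W := fun y hy => (hCO (hBC (interior_subset hy))).1.2
  have hB𝓐 : B ∈ 𝓐 := by
    refine ⟨hB, ⟨P, hP, fun y hy => (hCO (closure_minimal hBC hCcl hy)).1.1⟩, fun y hy z hz => ?_⟩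
    have hy' := Metric.mem_ball.1 (hCO (hBC hy)).2
    have hz' := Metric.mem_ball.1 (hCO (hBC hz)).2
    rw [Metric.mem_ball]
    linarith [dist_triangle_right z y x]
  have hins : insert B 𝓠 ∈ {𝓒 : Set (Set X) | 𝓒 ⊆ 𝓐 ∧ 𝓒.PairwiseDisjoint interior} := by
    refine ⟨insert_subset hB𝓐 h𝓠𝓐, hdisj.insert fun Q hQ _ => ?_⟩
    rw [disjoint_comm, disjoint_iff_inter_eq_empty, ← subset_empty_iff, ← hno Q hQ]
    exact inter_subset_inter_right _ hBW
  have hBQ : B ∈ 𝓠 := h𝓠.le_of_ge hins (subset_insert B 𝓠) (mem_insert B 𝓠)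
  obtain ⟨y, hy⟩ := h𝓑.1 B hB
  have : y ∈ interior B ∩ W := ⟨hy, hBW hy⟩
  rw [hno B hBQ] at this
  exact this

variable {X : Type*} [TopologicalSpace X]

lemma ToddPseudocomplete.exists_isCompleteTree [MetrizableSpace X] (h : ToddPseudocomplete X) :
    ∃ 𝓤 : ℕ → Set (Set X), IsCompleteTree 𝓤 := by
  let := metrizableSpaceMetric X
  obtain ⟨𝓑, hcent, hbase⟩ := h
  let D := {𝓓 : Set (Set X) //
    ∀ W : Set X, IsOpen W → W.Nonempty → ∃ P ∈ 𝓓, (interior P ∩ W).Nonempty}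
  have hstep : ∀ (n : ℕ) (𝓓 : D), ∃ 𝓠 : D, 𝓠.1 ⊆ 𝓑 n ∧
      (∀ Q ∈ 𝓠.1, ∃ P ∈ 𝓓.1, closure Q ⊆ interior P) ∧
      (∀ Q ∈ 𝓠.1, ∀ x ∈ Q, Q ⊆ Metric.ball x ((1 / 2 : ℝ) ^ n)) ∧
      𝓠.1.PairwiseDisjoint interior := by
    intro n 𝓓
    obtain ⟨𝓠, h1, h2, h3, h4, h5⟩ := (hbase n).exists_disjoint_refinement 𝓓.2
      (show (0 : ℝ) < (1 / 2) ^ n by positivity)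
    exact ⟨⟨𝓠, h5⟩, h1, h2, h3, h4⟩
  choose next hsub href hsmall hdisj using hstep
  let 𝓢 : ℕ → D := fun n => Nat.rec
    (next 0 ⟨{univ}, fun W _ hne => ⟨univ, rfl, by simpa using hne⟩⟩)
    (fun n 𝓓 => next (n + 1) 𝓓) n
  have hS : ∀ n, ∃ 𝓓 : D, 𝓢 n = next n 𝓓 := by
    rintro (_ | n)
    · exact ⟨_, rfl⟩
    · exact ⟨𝓢 n, rfl⟩
  have hsubS : ∀ n, (𝓢 n).1 ⊆ 𝓑 n := fun n => by
    obtain ⟨𝓓, h𝓓⟩ := hS n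
    rw [h𝓓]
    exact hsub n 𝓓
  have hsmallS : ∀ n, ∀ Q ∈ (𝓢 n).1, ∀ x ∈ Q, Q ⊆ Metric.ball x ((1 / 2 : ℝ) ^ n) := fun n => by
    obtain ⟨𝓓, h𝓓⟩ := hS n
    rw [h𝓓]
    exact hsmall n 𝓓
  have hdisjS : ∀ n, (𝓢 n).1.PairwiseDisjoint interior := fun n => by
    obtain ⟨𝓓, h𝓓⟩ := hS n
    rw [h𝓓]
    exact hdisj n 𝓓
  have hrefS : ∀ n, ∀ Q ∈ (𝓢 (n + 1)).1, ∃ P ∈ (𝓢 n).1, closure Q ⊆ interior P :=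
    fun n => href (n + 1) (𝓢 n)
  have heqS : ∀ n, ∀ P ∈ (𝓢 n).1, ∀ Q ∈ (𝓢 n).1, (interior P ∩ interior Q).Nonempty → P = Q :=
    fun n P hP Q hQ hPQ => (hdisjS n).elim hP hQ (not_disjoint_iff_nonempty_inter.2 hPQ)
  refine ⟨fun n => interior '' (𝓢 n).1, ?_, ?_, ?_, ?_, ?_, ?_, ?_⟩
  · rintro n _ ⟨P, -, rfl⟩
    exact isOpen_interior
  · rintro n _ ⟨P, hP, rfl⟩
    exact (hbase n).1 P (hsubS n hP)
  · rintro n _ ⟨P, hP, rfl⟩ _ ⟨Q, hQ, rfl⟩ hPQ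
    rw [heqS n P hP Q hQ hPQ]
  · intro n W hW hne
    obtain ⟨P, hP, hPW⟩ := (𝓢 n).2 W hW hne
    exact ⟨_, mem_image_of_mem _ hP, hPW⟩
  · rintro n _ ⟨Q, hQ, rfl⟩
    obtain ⟨P, hP, hQP⟩ := hrefS n Q hQ
    exact ⟨_, mem_image_of_mem _ hP, interior_subset.trans (subset_closure.trans hQP)⟩
  · intro x O hO hxO
    obtain ⟨ε, hε, hεO⟩ := Metric.isOpen_iff.1 hO x hxO
    obtain ⟨n, hn⟩ := exists_pow_lt_of_lt_one hε (show (1 / 2 : ℝ) < 1 by norm_num)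
    refine ⟨n, ?_⟩
    rintro _ ⟨P, hP, rfl⟩ hxP
    exact interior_subset.trans ((hsmallS n P hP x (interior_subset hxP)).trans
      ((Metric.ball_subset_ball hn.le).trans hεO))
  · intro U hU hanti
    choose B hB hBU using hU
    -- A branch is nested because the parent containing `closure (B (n + 1))` meets `B n` in its
    -- interior, and so equals it.
    have hnest : IsNested B := fun n => by
      obtain ⟨P, hP, hBP⟩ := hrefS n _ (hB (n + 1))
      have hne : (interior (B n) ∩ interior P).Nonempty := by
        refine ((hbase _).1 _ (hsubS (n + 1) (hB (n + 1)))).mono (subset_inter ?_ ?_)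
        · rw [hBU, hBU]
          exact hanti n.le_succ
        · exact interior_subset.trans (subset_closure.trans hBP)
      rwa [heqS n _ (hB n) P hP hne]
    obtain ⟨x, hx⟩ := hcent B hnest fun n => hsubS n (hB n)
    rw [mem_iInter] at hx
    refine ⟨x, mem_iInter.2 fun n => ?_⟩
    rw [← hBU]
    exact hnest n (subset_closure (hx (n + 1)))

/-- Smallness is measured only on the traces on `Z`; points of `Z` chosen in a nested sequence are
Cauchy there. -/
lemma oxtobyPseudocomplete_of_dense {Z : Set X} (hZ : Dense Z) [IsCompletelyMetrizableSpace Z] :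
    OxtobyPseudocomplete X := by
  let := upgradeIsCompletelyMetrizable Z
  refine ⟨fun n => {U | IsOpen U ∧ U.Nonempty ∧
    ∀ a b : Z, a.1 ∈ U → b.1 ∈ U → dist a b ≤ (1 / 2 : ℝ) ^ n}, ⟨?_, fun n => ⟨?_, ?_⟩⟩,
    fun n B hB => hB.1⟩
  · intro B hB hmem
    have hz : ∀ n, ∃ z : Z, z.1 ∈ B n := fun n => by
      obtain ⟨z, hz, hzZ⟩ := hZ.inter_open_nonempty _ (hmem n).1 (hmem n).2.1
      exact ⟨⟨z, hzZ⟩, hz⟩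
    choose z hz using hz
    have hzm : ∀ n m, n ≤ m → (z m).1 ∈ B n := fun n m hnm => hB.antitone hnm (hz m)
    have hc : CauchySeq z := cauchySeq_of_le_tendsto_0 (fun n => (1 / 2 : ℝ) ^ n)
      (fun n m N hn hm => (hmem N).2.2 _ _ (hzm N n hn) (hzm N m hm))
      (tendsto_pow_atTop_nhds_zero_of_lt_one (by norm_num) (by norm_num))
    obtain ⟨w, hw⟩ := cauchySeq_tendsto_of_complete hc
    have hw' : Tendsto (fun n => (z n).1) atTop (𝓝 w.1) :=
      (continuous_subtype_val.tendsto w).comp hw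
    refine ⟨w.1, mem_iInter.2 fun n => interior_subset (hB n ?_)⟩
    exact mem_closure_of_tendsto hw' (eventually_atTop.2 ⟨n + 1, fun m hm => hzm _ m hm⟩)
  · rintro B ⟨hB, hne, -⟩
    rwa [hB.interior_eq]
  · intro O hO hne
    obtain ⟨z, hzO, hzZ⟩ := hZ.inter_open_nonempty O hO hne
    have hball : IsOpen (Metric.ball (⟨z, hzZ⟩ : Z) ((1 / 2 : ℝ) ^ n / 2)) := Metric.isOpen_ball
    obtain ⟨V, hV, hVb⟩ := isOpen_induced_iff.1 hball
    have hVb' : ∀ a : Z, a.1 ∈ V → dist a ⟨z, hzZ⟩ < (1 / 2 : ℝ) ^ n / 2 := fun a ha => by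
      have : a ∈ (Subtype.val ⁻¹' V : Set Z) := ha
      rwa [hVb] at this
    have hzV : z ∈ V := by
      have : (⟨z, hzZ⟩ : Z) ∈ (Subtype.val ⁻¹' V : Set Z) := by
        rw [hVb]
        exact Metric.mem_ball_self (by positivity)
      exact this
    refine ⟨V ∩ O, ⟨hV.inter hO, ⟨z, hzV, hzO⟩, fun a b ha hb => ?_⟩, inter_subset_right⟩
    have h1 := hVb' a ha.1
    have h2 := hVb' b hb.1
    linarith [dist_triangle_right a b ⟨z, hzZ⟩]

end Metric

/-! ### Čech-completeness -/

section CechComplete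

variable {X : Type*} [TopologicalSpace X]

lemma cechComplete_of_isCompletelyMetrizableSpace [IsCompletelyMetrizableSpace X] :
    CechComplete X := by
  let := upgradeIsCompletelyMetrizable X
  refine ⟨inferInstance, ?_⟩
  let ι : X → StoneCech X := stoneCechUnit
  have hemb : IsEmbedding ι := isEmbedding_stoneCechUnit
  -- A point of every `O n` has a Cauchy neighbourhood trace on `X`, so completeness puts it in the
  -- image of `X`.
  let O : ℕ → Set (StoneCech X) := fun n => ⋃₀ {W | IsOpen W ∧
    ∀ a b, ι a ∈ W → ι b ∈ W → dist a b ≤ (1 / 2 : ℝ) ^ n}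
  have hO : ∀ n, IsOpen (O n) := fun n => isOpen_sUnion fun W hW => hW.1
  have hrange : range ι = ⋂ n, O n := by
    refine Subset.antisymm ?_ fun p hp => ?_
    · rintro _ ⟨x, rfl⟩
      refine mem_iInter.2 fun n => ?_
      obtain ⟨W, hW, hWb⟩ := hemb.isInducing.isOpen_iff.1
        (Metric.isOpen_ball (x := x) (ε := (1 / 2 : ℝ) ^ n / 2))
      have hmem : ∀ a, ι a ∈ W ↔ dist a x < (1 / 2 : ℝ) ^ n / 2 := fun a => by
        rw [← mem_preimage, hWb, Metric.mem_ball]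
      refine ⟨W, ⟨hW, fun a b ha hb => ?_⟩, (hmem x).2 (by simp)⟩
      linarith [dist_triangle_right a b x, (hmem a).1 ha, (hmem b).1 hb]
    · rw [mem_iInter] at hp
      have hne : (comap ι (𝓝 p)).NeBot := isDenseEmbedding_stoneCechUnit.isDenseInducing.comap_nhds_neBot p
      have hc : Cauchy (comap ι (𝓝 p)) := by
        refine Metric.cauchy_iff.2 ⟨hne, fun ε hε => ?_⟩
        obtain ⟨n, hn⟩ := exists_pow_lt_of_lt_one hε (show (1 / 2 : ℝ) < 1 by norm_num)
        obtain ⟨W, ⟨hW, hWd⟩, hpW⟩ := hp n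
        exact ⟨ι ⁻¹' W, preimage_mem_comap (hW.mem_nhds hpW),
          fun a ha b hb => (hWd a b ha hb).trans_lt hn⟩
      obtain ⟨x, hx⟩ := CompleteSpace.complete hc
      have h1 : Tendsto ι (comap ι (𝓝 p)) (𝓝 (ι x)) := (hemb.continuous.tendsto x).mono_left hx
      exact ⟨x, tendsto_nhds_unique h1 tendsto_comap⟩
  change IsGδ (range ι)
  rw [hrange]
  exact .iInter_of_isOpen hO

lemma CechComplete.telgarskyPseudocomplete (h : CechComplete X) : TelgarskyPseudocomplete X := by
  obtain ⟨hT, hG⟩ := h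
  let ι : X → StoneCech X := stoneCechUnit
  have hemb : IsEmbedding ι := isEmbedding_stoneCechUnit
  obtain ⟨O, hO, hrange⟩ := hG.eq_iInter_nat
  change range ι = _ at hrange
  -- With closures in `StoneCech X` inside `O n`, compactness yields a common point, which lies in
  -- `⋂ n, O n` and so in `X`.
  have hbasis : ∀ n, IsTopologicalBasis
      {U : Set X | IsOpen U ∧ U.Nonempty ∧ closure (ι '' U) ⊆ O n} := fun n => by
    refine isTopologicalBasis_of_isOpen_of_nhds (fun U hU => hU.1) fun x W hxW hW => ?_
    obtain ⟨W', hW', rfl⟩ := hemb.isInducing.isOpen_iff.1 hW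
    have hxO : ι x ∈ O n := mem_iInter.1 (hrange ▸ mem_range_self x) n
    obtain ⟨C, hC, hCcl, hCW⟩ := exists_mem_nhds_isClosed_subset
      ((hW'.inter (hO n)).mem_nhds ⟨hxW, hxO⟩)
    have hx : x ∈ ι ⁻¹' interior C := mem_interior_iff_mem_nhds.2 hC
    refine ⟨ι ⁻¹' interior C, ⟨isOpen_interior.preimage hemb.continuous, ⟨x, hx⟩, ?_⟩, hx,
      fun y hy => (hCW (interior_subset hy)).1⟩
    exact (closure_minimal ((image_preimage_subset _ _).trans interior_subset) hCcl).trans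
      fun y hy => (hCW hy).2
  refine ⟨_, ⟨?_, fun n => ⟨?_, ?_⟩⟩, hbasis⟩
  · intro B hB hmem
    obtain ⟨p, hp⟩ := IsCompact.nonempty_iInter_of_sequence_nonempty_isCompact_isClosed
      (fun n => closure (ι '' B n))
      (fun n => closure_mono (image_mono (hB.antitone n.le_succ)))
      (fun n => ((hmem n).2.1.image ι).closure) isClosed_closure.isCompact
      (fun n => isClosed_closure)
    rw [mem_iInter] at hp
    obtain ⟨x, rfl⟩ : p ∈ range ι := by
      rw [hrange]
      exact mem_iInter.2 fun n => (hmem n).2.2 (hp n)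
    refine ⟨x, mem_iInter.2 fun n => interior_subset (hB n ?_)⟩
    rw [hemb.isInducing.closure_eq_preimage_closure_image]
    exact hp (n + 1)
  · rintro B ⟨hB, hne, -⟩
    rwa [hB.interior_eq]
  · rintro W hW ⟨x, hx⟩
    obtain ⟨U, hU, -, hUW⟩ := (hbasis n).exists_subset_of_mem_open hx hW
    exact ⟨U, hU, hUW⟩

end CechComplete

/-! ### Completeness of the two-sided uniformity -/

section Group

variable {G : Type*} [Group G] [TopologicalSpace G] [IsTopologicalGroup G]

/-- In an Oxtoby countably compact metrizable group every two-sided Cauchy sequence converges. -/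
lemma OxtobyCC.exists_tendsto [MetrizableSpace G] (h : OxtobyCC G) {g : ℕ → G}
    (hl : ∀ N ∈ 𝓝 (1 : G), ∃ k, ∀ m ≥ k, ∀ n ≥ k, (g m)⁻¹ * g n ∈ N)
    (hr : ∀ N ∈ 𝓝 (1 : G), ∃ k, ∀ m ≥ k, ∀ n ≥ k, g m * (g n)⁻¹ ∈ N) :
    ∃ y, Tendsto g atTop (𝓝 y) := by
  let := metrizableSpaceMetric G
  obtain ⟨𝓑, hcc, hbase, hopen⟩ := h
  let S := {s : Set G × Set G × ℕ //
    (IsOpen s.1 ∧ s.1.Nonempty) ∧ ∀ m ≥ s.2.2, ∀ u ∈ s.1, g m * u ∈ s.2.1}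
  have hstep : ∀ (n : ℕ) (s : S), ∃ t : S, t.1.1 ∈ 𝓑 ∧ t.1.2.1 ∈ 𝓑 ∧ t.1.1 ⊆ s.1.1 ∧
      t.1.2.1 ⊆ s.1.2.1 ∧ ∀ x ∈ t.1.2.1, t.1.2.1 ⊆ Metric.ball x ((1 / 2 : ℝ) ^ n) := by
    rintro n ⟨⟨U, V, k⟩, ⟨hU, x₀, hx₀⟩, hUV⟩
    dsimp only at hU hx₀ hUV
    have hs : {a : G | a * x₀ ∈ U} ∈ 𝓝 (1 : G) :=
      (hU.preimage (continuous_mul_const x₀)).mem_nhds (by simpa using hx₀)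
    obtain ⟨N, hN, hN1, hNU⟩ := exists_open_nhds_one_split hs
    obtain ⟨k₀, hk₀⟩ := hl N (hN.mem_nhds hN1)
    let i := max k k₀
    -- The left Cauchy condition makes `(g m)⁻¹` carry all of `O` into `U` for every `m ≥ i`.
    let O : Set G := {y | (g i)⁻¹ * y * x₀⁻¹ ∈ N} ∩ Metric.ball (g i * x₀) ((1 / 2 : ℝ) ^ n / 2)
    have hO : IsOpen O := (hN.preimage (by fun_prop)).inter Metric.isOpen_ball
    have hOU : ∀ y ∈ O, ∀ m ≥ i, (g m)⁻¹ * y ∈ U := fun y hy m hm => by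
      have := hNU _ (hk₀ m ((le_max_right _ _).trans hm) i (le_max_right _ _)) _ hy.1
      simpa [mul_assoc] using this
    obtain ⟨V', hV', hV'O⟩ := hbase.2 O hO ⟨g i * x₀, by simpa [mul_assoc] using hN1,
      Metric.mem_ball_self (by positivity)⟩
    obtain ⟨v₀, hv₀⟩ := hcc.1 V' hV'
    have hs' : {a : G | a * v₀ ∈ V'} ∈ 𝓝 (1 : G) :=
      ((hopen V' hV').preimage (continuous_mul_const v₀)).mem_nhds (by simpa using hv₀)
    obtain ⟨N', hN', hN1', hNV⟩ := exists_open_nhds_one_split hs'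
    obtain ⟨k₁, hk₁⟩ := hr N' (hN'.mem_nhds hN1')
    let j := max i k₁
    -- Dually, the right Cauchy condition makes `g m` carry `U'` into `V'` for every `m ≥ j`.
    obtain ⟨U', hU', hU'O⟩ := hbase.2 {u | g j * u * v₀⁻¹ ∈ N'}
      (hN'.preimage (by fun_prop)) ⟨(g j)⁻¹ * v₀, by simpa using hN1'⟩
    have hmap : ∀ m ≥ j, ∀ u ∈ U', g m * u ∈ V' := fun m hm u hu => by
      have := hNV _ (hk₁ m ((le_max_right _ _).trans hm) j (le_max_right _ _)) _ (hU'O hu)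
      simpa [mul_assoc] using this
    refine ⟨⟨⟨U', V', j⟩, ⟨hopen U' hU', hcc.1 U' hU'⟩, hmap⟩, hU', hV', fun u hu => ?_, fun v hv => ?_, fun x hx y hy => ?_⟩
    · simpa using hOU _ (hV'O (hmap j le_rfl u hu)) j (le_max_left _ _)
    · simpa using hUV i (le_max_left _ _) _ (hOU v (hV'O hv) i le_rfl)
    · have hx' := Metric.mem_ball.1 (hV'O hx).2
      have hy' := Metric.mem_ball.1 (hV'O hy).2
      rw [Metric.mem_ball]
      linarith [dist_triangle_right y x (g i * x₀)]
  choose next h𝓑U h𝓑V hsubU hsubV hsmall using hstep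
  let s : ℕ → S := fun n =>
    Nat.rec ⟨⟨univ, univ, 0⟩, ⟨isOpen_univ, univ_nonempty⟩, fun _ _ _ _ => mem_univ _⟩
      (fun n t => next n t) n
  -- The shift skips the initial state, whose sets need not belong to `𝓑`.
  obtain ⟨x, hx⟩ := hcc.2 (fun n => (s (n + 1)).1.1)
    (antitone_nat_of_succ_le fun n => hsubU _ (s (n + 1))) fun n => h𝓑U n (s n)
  obtain ⟨y, hy⟩ := hcc.2 (fun n => (s (n + 1)).1.2.1)
    (antitone_nat_of_succ_le fun n => hsubV _ (s (n + 1))) fun n => h𝓑V n (s n)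
  rw [mem_iInter] at hx hy
  have hlim : Tendsto (fun m => g m * x) atTop (𝓝 y) := by
    refine Metric.tendsto_atTop.2 fun ε hε => ?_
    obtain ⟨n, hn⟩ := exists_pow_lt_of_lt_one hε (show (1 / 2 : ℝ) < 1 by norm_num)
    exact ⟨(s (n + 1)).1.2.2, fun m hm =>
      (Metric.mem_ball.1 (hsmall n (s n) y (hy n) ((s (n + 1)).2.2 m hm x (hx n)))).trans hn⟩
  exact ⟨y * x⁻¹, by simpa using hlim.mul_const x⁻¹⟩

open scoped Uniformity in
-- Left and right uniformities induce the same topology, hence so does their infimum. It is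
-- countably generated, so convergence of Cauchy sequences suffices.
lemma OxtobyCC.isCompletelyMetrizableSpace [MetrizableSpace G] (h : OxtobyCC G) :
    IsCompletelyMetrizableSpace G := by
  let u : UniformSpace G :=
    IsTopologicalGroup.leftUniformSpace G ⊓ IsTopologicalGroup.rightUniformSpace G
  have hu : u.toTopologicalSpace = ‹TopologicalSpace G› := inf_idem _
  have huni : 𝓤[u] = comap (fun p : G × G => p.1⁻¹ * p.2) (𝓝 1) ⊓
      comap (fun p : G × G => p.2 * p.1⁻¹) (𝓝 1) := rfl
  have hcount : 𝓤[u].IsCountablyGenerated := by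
    rw [huni]
    infer_instance
  have hcomplete : @CompleteSpace G u := by
    refine @UniformSpace.complete_of_cauchySeq_tendsto G u hcount fun g hg => ?_
    have hg' : Tendsto (fun p : ℕ × ℕ => (g p.1, g p.2)) atTop 𝓤[u] :=
      (@cauchySeq_iff_tendsto _ _ u _ _ g).1 hg
    rw [huni, tendsto_inf, tendsto_comap_iff, tendsto_comap_iff] at hg'
    obtain ⟨y, hy⟩ := h.exists_tendsto (g := g)
      (fun N hN => by
        obtain ⟨⟨a, b⟩, hab⟩ := eventually_atTop.1 (hg'.1 hN)
        exact ⟨max a b, fun m hm n hn =>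
          hab (m, n) ⟨(le_max_left _ _).trans hm, (le_max_right _ _).trans hn⟩⟩)
      (fun N hN => by
        obtain ⟨⟨a, b⟩, hab⟩ := eventually_atTop.1 (hg'.2 hN)
        exact ⟨max a b, fun m hm n hn =>
          hab (n, m) ⟨(le_max_left _ _).trans hn, (le_max_right _ _).trans hm⟩⟩)
    exact ⟨y, by rwa [hu]⟩
  have hT0 : @T0Space G u.toTopologicalSpace := by
    rw [hu]
    infer_instance
  exact ⟨@UniformSpace.metricSpace G u hcount hT0, hu, hcomplete⟩

end Group

end Pseudocomplete

theorem mainTheorem5 (G : Type*) [Group G] [TopologicalSpace G] [IsTopologicalGroup G]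
    [TopologicalSpace.MetrizableSpace G] :
    List.TFAE [
      Pseudocomplete.SanchezOkunevCC G,
      Pseudocomplete.OxtobyCC G,
      Pseudocomplete.ToddCC G,
      Pseudocomplete.StronglySanchezOkunevPseudocomplete G,
      Pseudocomplete.StronglyOxtobyPseudocomplete G,
      Pseudocomplete.StronglyToddPseudocomplete G,
      Pseudocomplete.SanchezOkunevPseudocomplete G,
      Pseudocomplete.OxtobyPseudocomplete G,
      Pseudocomplete.ToddPseudocomplete G,
      Pseudocomplete.HasDenseZeroDimCompletelyMetrizable G,
      Pseudocomplete.CechComplete G,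
      Pseudocomplete.TelgarskyPseudocomplete G] := by
  tfae_have 1 → 4 := fun ⟨𝓑, hcc, hb, hz⟩ => ⟨𝓑, ⟨hcc.isCentered, fun _ => hb⟩, hz⟩
  tfae_have 2 → 5 := fun ⟨𝓑, hcc, hb, ho⟩ => ⟨𝓑, ⟨hcc.isCentered, fun _ => hb⟩, ho⟩
  tfae_have 3 → 6 := fun ⟨𝓑, hcc, hb⟩ => ⟨𝓑, hcc.isCentered, fun _ => hb⟩
  tfae_have 4 → 7 := fun ⟨𝓑, hc, hz⟩ => ⟨fun _ => 𝓑, hc, fun _ => hz⟩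
  tfae_have 5 → 8 := fun ⟨𝓑, hc, ho⟩ => ⟨fun _ => 𝓑, hc, fun _ => ho⟩
  tfae_have 6 → 9 := fun ⟨𝓑, hc⟩ => ⟨fun _ => 𝓑, hc⟩
  tfae_have 7 → 9 := fun ⟨𝓑, hc, _⟩ => ⟨𝓑, hc⟩
  tfae_have 8 → 9 := fun ⟨𝓑, hc, _⟩ => ⟨𝓑, hc⟩
  tfae_have 9 → 1 := fun h => let ⟨_, h𝓤⟩ := h.exists_isCompleteTree; h𝓤.sanchezOkunevCC
  tfae_have 9 → 2 := fun h => let ⟨_, h𝓤⟩ := h.exists_isCompleteTree; h𝓤.oxtobyCC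
  tfae_have 2 → 3 := fun ⟨𝓑, hcc, hb, _⟩ => ⟨𝓑, hcc, hb⟩
  tfae_have 9 → 10 := fun h =>
    let ⟨_, h𝓤⟩ := h.exists_isCompleteTree; h𝓤.hasDenseZeroDimCompletelyMetrizable
  tfae_have 10 → 8 := fun ⟨_, hZ, _, _⟩ => Pseudocomplete.oxtobyPseudocomplete_of_dense hZ
  tfae_have 2 → 11 := fun h =>
    have := h.isCompletelyMetrizableSpace
    Pseudocomplete.cechComplete_of_isCompletelyMetrizableSpace
  tfae_have 11 → 12 := fun h => h.telgarskyPseudocomplete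
  tfae_have 12 → 9 := fun ⟨𝓑, hc, _⟩ => ⟨𝓑, hc⟩
  tfae_finish
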